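/- Let $A\to M$ be a smooth real vector bundle of finite rank over a smooth (Hausdorff, second countable) manifold, equipped with a Lie algebroid structure $\mu=([\cdot,\cdot],\rho)$ with differential $d$, and let $H\in\Gamma(\bigwedge^3A^*)$ with $dH=0$. Let $\pi\in\Gamma(\bigwedge^2A)$, $\sigma\in\Gamma(\bigwedge^2A^*)$, $N\in\Gamma(A\otimes A^*)$, and write $\pi^\sharp\alpha=\pi(\alpha,\cdot)$, $\sigma^\flat X=\sigma(X,\cdot)$, ${}^tN\alpha=\alpha\circ N$. Let $\lambda\in\{-1,0,1\}$ and $$J=\begin{pmatrix}N&\pi^\sharp\\ \sigma^\flat&-{}^tN\end{pmatrix}:A\oplus A^*\to A\oplus A^* .$$ On $\Gamma(A\oplus A^*)$ use the pairing $\langle X+\alpha,Y+\beta\rangle=\beta(X)+\alpha(Y)$ and the Dorfman bracket of $\mu+H$, $$[X+\alpha,Y+\beta]=[X,Y]+\mathcal L_X\beta-i_Yd\alpha-H(X,Y,\cdot).$$ $J$ is called a c.p.s. structure on $(A\oplus A^*,\mu+H)$ (with $J^2=\lambda\,\mathrm{id}$) if $\langle Ju,v\rangle+\langle u,Jv\rangle=0$,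 $J^2=\lambda\,\mathrm{id}$, and $[Ju,Jv]-J([Ju,v]+[u,Jv]-J[u,v])=0$ for all $u,v\in\Gamma(A\oplus A^*)$. For $\psi\in\Gamma(\bigwedge^3A^*)$, the quadruple $(\pi,N,\psi,H)$ is called a Poisson quasi-Nijenhuis structure with background $H$ if $N\pi^\sharp=\pi^\sharp\,{}^tN$, $d\psi=0$, $dH=0$, $[\pi,\pi]_{SN}=0$, and for all $X,Y\in\Gamma(A)$, $\alpha,\beta\in\Gamma(A^*)$ $$C_{\pi,N}(\alpha,\beta)=2H(\pi^\sharp\alpha,\pi^\sharp\beta,\cdot),$$ $$T_N(X,Y)=-\pi^\sharp\big(H(NX,Y,\cdot)-H(NY,X,\cdot)+\psi(X,Y,\cdot)\big),$$ $$d_N\psi=d\mathcal H .$$ Here $[X,Y]_N=[NX,Y]+[X,NY]-N[X,Y]$; $T_N(X,Y)=[NX,NY]-N[X,Y]_N$; $d_N$ is the differential given by the Koszul formula for the bracket $[\cdot,\cdot]_N$ and the anchor $\rho\circ N$; $\mathcal H(X,Y,Z)=H(NX,NY,Z)+H(NY,NZ,X)+H(NZ,NX,Y)$; $[\alpha,\beta]_\pi=\mathcal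 L_{\pi^\sharp\alpha}\beta-\mathcal L_{\pi^\sharp\beta}\alpha-d(\pi(\alpha,\beta))$; and $$C_{\pi,N}(\alpha,\beta)=([\alpha,\beta]_N)_\pi-\big([{}^tN\alpha,\beta]_\pi+[\alpha,{}^tN\beta]_\pi-{}^tN[\alpha,\beta]_\pi\big),$$ where $([\cdot,\cdot]_N)_\pi$ is the bracket $[\cdot,\cdot]_\pi$ formed with $([\cdot,\cdot]_N,\rho\circ N)$ in place of $([\cdot,\cdot],\rho)$. Theorem. $J$ is a c.p.s. structure on $(A\oplus A^*,\mu+H)$ with $J^2=\lambda\,\mathrm{id}$ if and only if $(\pi,N,-d\sigma,H)$ is a Poisson quasi-Nijenhuis structure with background $H$ and $$N^2+\pi^\sharp\sigma^\flat=\lambda\,\mathrm{id}_A,\qquad \sigma^\flat N={}^tN\sigma^\flat,\qquad 2(i_Nd\sigma-\mathcal H)=d(i_N\sigma)+2\lambda H,$$ where $i_N$ acts on forms by $(i_N\omega)(X_1,\dots,X_k)=\sum_j\omega(X_1,\dots,NX_j,\dots,X_k)$. -/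

import Mathlib

open scoped Manifold ContDiff

noncomputable section

namespace LieAlgebroidGeometry

universe uM uF uA

/-! ### Smooth functions, sections and tensor fields

`M` is a smooth manifold of dimension `n` and `A → M` a smooth vector bundle with fibre `F`.
Tensor fields are described, as usual, by `C^∞(M)`-multilinear maps on the modules of smooth
sections. -/

/-- The algebra `C^∞(M)`. -/
abbrev SmoothFn (n : ℕ) (M : Type uM) [TopologicalSpace M]
    [ChartedSpace (EuclideanSpace ℝ (Fin n)) M] : Type uM :=
  C^∞⟮𝓡 n, M; ℝ⟯

/-- The space `Γ(A)` of smooth sections of the vector bundle `A`. -/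
abbrev Sec (n : ℕ) {M : Type uM} [TopologicalSpace M]
    [ChartedSpace (EuclideanSpace ℝ (Fin n)) M]
    (F : Type uF) [NormedAddCommGroup F] [NormedSpace ℝ F]
    (A : M → Type uA) [TopologicalSpace (Bundle.TotalSpace F A)]
    [∀ x, TopologicalSpace (A x)] [FiberBundle F A] :=
  Cₛ^∞⟮𝓡 n; F, A⟯

/-- Smooth vector fields on `M`. -/
abbrev VecField (n : ℕ) (M : Type uM) [TopologicalSpace M]
    [ChartedSpace (EuclideanSpace ℝ (Fin n)) M] [IsManifold (𝓡 n) ∞ M] :=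
  Cₛ^∞⟮𝓡 n; EuclideanSpace ℝ (Fin n), fun x : M => TangentSpace (𝓡 n) x⟯

section Basic

variable {n : ℕ} {M : Type uM} [TopologicalSpace M]
  [ChartedSpace (EuclideanSpace ℝ (Fin n)) M]
  {F : Type uF} [NormedAddCommGroup F] [NormedSpace ℝ F]
  {A : M → Type uA} [TopologicalSpace (Bundle.TotalSpace F A)]
  [∀ x, AddCommGroup (A x)] [∀ x, Module ℝ (A x)] [∀ x, TopologicalSpace (A x)]
  [FiberBundle F A] [VectorBundle ℝ F A]

/-- Multiplication of a section by a smooth function. -/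
instance instSMulSec : SMul (SmoothFn n M) (Sec n F A) :=
  ⟨fun f s => ⟨fun x => f x • s x, f.contMDiff.smul_section s.contMDiff⟩⟩

@[simp] theorem smulSec_apply (f : SmoothFn n M) (s : Sec n F A) (x : M) :
    (f • s) x = f x • s x := rfl

/-- `Γ(A)` is a module over `C^∞(M)`. -/
instance instModuleSec : Module (SmoothFn n M) (Sec n F A) where
  one_smul s := by ext x; simp
  mul_smul f g s := by ext x; simp [mul_smul]
  smul_zero f := by ext x; simp
  smul_add f s t := by ext x; simp
  add_smul f g s := by ext x; simp [add_smul]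
  zero_smul s := by ext x; simp

instance instIsScalarTowerSec : IsScalarTower ℝ (SmoothFn n M) (Sec n F A) where
  smul_assoc r f s := by ext x; simp [mul_smul]

theorem mdiff_smoothFn (f : SmoothFn n M) (x : M) : MDifferentiableAt (𝓡 n) 𝓘(ℝ) f x :=
  (f.contMDiff x).mdifferentiableAt (by simp)

variable [IsManifold (𝓡 n) ∞ M]

theorem contMDiff_deriv (V : VecField n M) (f : SmoothFn n M) :
    ContMDiff (𝓡 n) 𝓘(ℝ) ∞ (fun x => mvfderiv (𝓡 n) f x (V x)) := by
  have h1 : ContMDiff (𝓡 n) 𝓘(ℝ).tangent ∞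
      (fun x => tangentMap (𝓡 n) 𝓘(ℝ) f ⟨x, V x⟩) :=
    (f.contMDiff.contMDiff_tangentMap (m := ∞) (by simp)).comp V.contMDiff
  exact (contMDiff_snd_tangentBundle_modelSpace ℝ 𝓘(ℝ)).comp h1

/-- The derivative `V(f)` of a smooth function `f` along a vector field `V`. -/
def VecField.deriv (V : VecField n M) (f : SmoothFn n M) : SmoothFn n M :=
  ⟨fun x => mvfderiv (𝓡 n) f x (V x), contMDiff_deriv V f⟩


theorem VecField.deriv_apply (V : VecField n M) (f : SmoothFn n M) (x : M) :
    V.deriv f x = mvfderiv (𝓡 n) f x (V x) := rfl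

theorem VecField.deriv_add (V : VecField n M) (f g : SmoothFn n M) :
    V.deriv (f + g) = V.deriv f + V.deriv g := by
  ext x
  have := mvfderiv_add (mdiff_smoothFn f x) (mdiff_smoothFn g x)
  simp [VecField.deriv_apply, this]

theorem VecField.deriv_mul (V : VecField n M) (f g : SmoothFn n M) :
    V.deriv (f * g) = f * V.deriv g + g * V.deriv f := by
  ext x
  have := mvfderiv_mul (mdiff_smoothFn f x) (mdiff_smoothFn g x)
  simp [VecField.deriv_apply, this]

theorem VecField.deriv_neg (V : VecField n M) (f : SmoothFn n M) :
    V.deriv (-f) = -V.deriv f := by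
  ext x
  have := mvfderiv_neg (I := 𝓡 n) (g := f) (x := x)
  simp [VecField.deriv_apply, this]

theorem VecField.deriv_zero (V : VecField n M) : V.deriv 0 = 0 := by
  simpa using V.deriv_add 0 0

theorem VecField.add_deriv (V W : VecField n M) (f : SmoothFn n M) :
    (V + W).deriv f = V.deriv f + W.deriv f := by
  ext x
  simp [VecField.deriv_apply]

theorem VecField.smul_deriv (g : SmoothFn n M) (V : VecField n M) (f : SmoothFn n M) :
    VecField.deriv (g • V) f = g * V.deriv f := by
  ext x
  simp [VecField.deriv_apply]

end Basic

section TensorFields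

variable (n : ℕ) {M : Type uM} [TopologicalSpace M]
  [ChartedSpace (EuclideanSpace ℝ (Fin n)) M]
  (F : Type uF) [NormedAddCommGroup F] [NormedSpace ℝ F]
  (A : M → Type uA) [TopologicalSpace (Bundle.TotalSpace F A)]
  [∀ x, AddCommGroup (A x)] [∀ x, Module ℝ (A x)] [∀ x, TopologicalSpace (A x)]
  [FiberBundle F A] [VectorBundle ℝ F A]

/-- `Γ(A*)`: the `C^∞(M)`-linear maps `Γ(A) → C^∞(M)`. -/
abbrev Cov := Sec n F A →ₗ[SmoothFn n M] SmoothFn n M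

/-- `Γ(A ⊗ A*)`: the `(1,1)`-tensors on `A`. -/
abbrev Endo := Sec n F A →ₗ[SmoothFn n M] Sec n F A

/-- `Γ(⋀² A*)`: alternating `C^∞(M)`-bilinear maps on `Γ(A)`. The linear map `σ.toLin` is `σ♭`,
that is `σ♭ X = σ(X, ·)`. -/
structure TwoForm where
  toLin : Sec n F A →ₗ[SmoothFn n M] Cov n F A
  alt : ∀ X, toLin X X = 0

/-- `Γ(⋀³ A*)`: alternating `C^∞(M)`-trilinear maps on `Γ(A)`. The element `H.toLin X Y` of `Γ(A*)`
is `H(X, Y, ·)`. -/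
structure ThreeForm where
  toLin : Sec n F A →ₗ[SmoothFn n M] Sec n F A →ₗ[SmoothFn n M] Cov n F A
  alt₁₂ : ∀ X Z, toLin X X Z = 0
  alt₂₃ : ∀ X Y, toLin X Y Y = 0

/-- `Γ(⋀² A)`: a bivector `π` is given by the map `π♯ : Γ(A*) → Γ(A)`, `π♯ α = π(α, ·)`, which is
skew. -/
structure Bivector where
  sharp : Cov n F A →ₗ[SmoothFn n M] Sec n F A
  skew : ∀ α : Cov n F A, α (sharp α) = 0

end TensorFields

section Operations

variable {n : ℕ} {M : Type uM} [TopologicalSpace M]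
  [ChartedSpace (EuclideanSpace ℝ (Fin n)) M]
  {F : Type uF} [NormedAddCommGroup F] [NormedSpace ℝ F]
  {A : M → Type uA} [TopologicalSpace (Bundle.TotalSpace F A)]
  [∀ x, AddCommGroup (A x)] [∀ x, Module ℝ (A x)] [∀ x, TopologicalSpace (A x)]
  [FiberBundle F A] [VectorBundle ℝ F A]

/-- The flat map `σ♭ X = σ(X, ·)`. -/
def TwoForm.flat (σ : TwoForm n F A) : Sec n F A →ₗ[SmoothFn n M] Cov n F A := σ.toLin

/-- The value `π(α, β) = β(π♯ α)`. -/
def Bivector.eval (π : Bivector n F A) (α β : Cov n F A) : SmoothFn n M := β (π.sharp α)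

/-- The transpose `ᵗN` acting on `Γ(A*)`: `(ᵗN α)(X) = α(N X)`. -/
def Endo.transpose (N : Endo n F A) : Cov n F A →ₗ[SmoothFn n M] Cov n F A where
  toFun α := α.comp N
  map_add' _ _ := rfl
  map_smul' _ _ := rfl

theorem smoothFn_eq_zero_of_eq_neg {f : SmoothFn n M} (h : f = -f) : f = 0 := by
  ext x
  have : f x = -f x := congrArg (fun g : SmoothFn n M => g x) h
  change f x = 0
  linarith

/-- A `2`-form from a skew function which is `C^∞(M)`-linear in the last argument. -/
def TwoForm.ofFun (f : Sec n F A → Sec n F A → SmoothFn n M)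
    (add : ∀ X Y Y', f X (Y + Y') = f X Y + f X Y')
    (smul : ∀ X (c : SmoothFn n M) Y, f X (c • Y) = c * f X Y)
    (skew : ∀ X Y, f X Y = -f Y X) : TwoForm n F A where
  toLin :=
    { toFun := fun X =>
        { toFun := f X
          map_add' := add X
          map_smul' := smul X }
      map_add' := fun X X' => by
        ext1 Y
        change f (X + X') Y = f X Y + f X' Y
        rw [skew, add, skew Y X, skew Y X']; ring
      map_smul' := fun c X => by
        ext1 Y
        change f (c • X) Y = c * f X Y
        rw [skew, smul, skew Y X]; ring }
  alt X := smoothFn_eq_zero_of_eq_neg (skew X X)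

/-- A `3`-form from a skew function which is `C^∞(M)`-linear in the last argument. -/
def ThreeForm.ofFun (f : Sec n F A → Sec n F A → Sec n F A → SmoothFn n M)
    (add : ∀ X Y Z Z', f X Y (Z + Z') = f X Y Z + f X Y Z')
    (smul : ∀ X Y (c : SmoothFn n M) Z, f X Y (c • Z) = c * f X Y Z)
    (skew₁₂ : ∀ X Y Z, f X Y Z = -f Y X Z)
    (skew₂₃ : ∀ X Y Z, f X Y Z = -f X Z Y) : ThreeForm n F A where
  toLin :=
    { toFun := fun X => (TwoForm.ofFun (f X) (add X) (smul X) (skew₂₃ X)).toLin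
      map_add' := fun X X' => by
        refine LinearMap.ext fun Y => LinearMap.ext fun Z => ?_
        change f (X + X') Y Z = f X Y Z + f X' Y Z
        rw [skew₁₂, skew₂₃, add, skew₂₃ Y Z X, skew₂₃ Y Z X', skew₁₂ Y X, skew₁₂ Y X']; ring
      map_smul' := fun c X => by
        refine LinearMap.ext fun Y => LinearMap.ext fun Z => ?_
        change f (c • X) Y Z = c * f X Y Z
        rw [skew₁₂, skew₂₃, smul, skew₂₃ Y Z X, skew₁₂ Y X]; ring }
  alt₁₂ X Z := smoothFn_eq_zero_of_eq_neg (skew₁₂ X X Z)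
  alt₂₃ X Y := smoothFn_eq_zero_of_eq_neg (skew₂₃ X Y Y)

theorem TwoForm.skew (σ : TwoForm n F A) (X Y : Sec n F A) :
    σ.toLin X Y = -σ.toLin Y X := by
  have h := σ.alt (X + Y)
  simp only [map_add, LinearMap.add_apply, σ.alt, zero_add, add_zero] at h
  exact eq_neg_of_add_eq_zero_right h

theorem ThreeForm.skew₁₂ (H : ThreeForm n F A) (X Y Z : Sec n F A) :
    H.toLin X Y Z = -H.toLin Y X Z := by
  have h := H.alt₁₂ (X + Y) Z
  simp only [map_add, LinearMap.add_apply, H.alt₁₂, zero_add, add_zero] at h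
  exact eq_neg_of_add_eq_zero_right h

theorem ThreeForm.skew₂₃ (H : ThreeForm n F A) (X Y Z : Sec n F A) :
    H.toLin X Y Z = -H.toLin X Z Y := by
  have h := H.alt₂₃ X (Y + Z)
  simp only [map_add, LinearMap.add_apply, H.alt₂₃, zero_add, add_zero] at h
  exact eq_neg_of_add_eq_zero_right h

instance : Neg (ThreeForm n F A) where
  neg H := .ofFun (fun X Y Z => -H.toLin X Y Z)
    (fun X Y Z Z' => by simp only [map_add]; ring)
    (fun X Y c Z => by simp only [map_smul, smul_eq_mul]; ring)
    (fun X Y Z => by rw [H.skew₁₂ X])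
    (fun X Y Z => by rw [H.skew₂₃ X])

/-- `(i_N σ)(X, Y) = σ(NX, Y) + σ(X, NY)`. -/
def TwoForm.contract (N : Endo n F A) (σ : TwoForm n F A) : TwoForm n F A :=
  .ofFun (fun X Y => σ.toLin (N X) Y + σ.toLin X (N Y))
    (fun X Y Y' => by simp only [map_add]; ring)
    (fun X c Y => by simp only [map_smul, smul_eq_mul]; ring)
    (fun X Y => by rw [σ.skew (N X), σ.skew X]; ring)

/-- `(i_N H)(X, Y, Z) = H(NX, Y, Z) + H(X, NY, Z) + H(X, Y, NZ)`. -/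
def ThreeForm.contract (N : Endo n F A) (H : ThreeForm n F A) : ThreeForm n F A :=
  .ofFun (fun X Y Z => H.toLin (N X) Y Z + H.toLin X (N Y) Z + H.toLin X Y (N Z))
    (fun X Y Z Z' => by simp only [map_add]; ring)
    (fun X Y c Z => by simp only [map_smul, smul_eq_mul]; ring)
    (fun X Y Z => by rw [H.skew₁₂ (N X), H.skew₁₂ X (N Y), H.skew₁₂ X Y]; ring)
    (fun X Y Z => by rw [H.skew₂₃ (N X), H.skew₂₃ X (N Y), H.skew₂₃ X Y]; ring)

/-- The `3`-form `ℋ(X, Y, Z) = H(NX, NY, Z) + H(NY, NZ, X) + H(NZ, NX, Y)`. -/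
def ThreeForm.contractTwice (N : Endo n F A) (H : ThreeForm n F A) : ThreeForm n F A :=
  .ofFun (fun X Y Z =>
      H.toLin (N X) (N Y) Z + H.toLin (N Y) (N Z) X + H.toLin (N Z) (N X) Y)
    (fun X Y Z Z' => by simp only [map_add, LinearMap.add_apply]; ring)
    (fun X Y c Z => by simp only [map_smul, LinearMap.smul_apply, smul_eq_mul]; ring)
    (fun X Y Z => by
      rw [H.skew₁₂ (N X) (N Y), H.skew₁₂ (N Y) (N Z), H.skew₁₂ (N Z) (N X)]; ring)
    (fun X Y Z => by
      rw [H.skew₁₂ (N X) (N Y), H.skew₁₂ (N Y) (N Z), H.skew₁₂ (N Z) (N X)]; ring)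

end Operations

/-! ### Lie algebroids and their calculus -/

section Algebroid

/-- A skew-symmetric bracket on `Γ(A)` with an anchor `ρ : A → TM` for which the Leibniz rule
`[X, fY] = f[X, Y] + ρ(X)(f) Y` holds; the Jacobi identity is not required. -/
structure SkewAlgebroid (n : ℕ) {M : Type uM} [TopologicalSpace M]
    [ChartedSpace (EuclideanSpace ℝ (Fin n)) M] [IsManifold (𝓡 n) ∞ M]
    (F : Type uF) [NormedAddCommGroup F] [NormedSpace ℝ F]
    (A : M → Type uA) [TopologicalSpace (Bundle.TotalSpace F A)]
    [∀ x, AddCommGroup (A x)] [∀ x, Module ℝ (A x)] [∀ x, TopologicalSpace (A x)]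
    [FiberBundle F A] [VectorBundle ℝ F A] where
  anchor : Sec n F A →ₗ[SmoothFn n M] VecField n M
  bracket : Sec n F A →ₗ[ℝ] Sec n F A →ₗ[ℝ] Sec n F A
  bracket_self : ∀ X, bracket X X = 0
  leibniz : ∀ X (f : SmoothFn n M) Y,
    bracket X (f • Y) = f • bracket X Y + (anchor X).deriv f • Y

/-- A Lie algebroid structure on `A`. -/
structure LieAlgebroid (n : ℕ) {M : Type uM} [TopologicalSpace M]
    [ChartedSpace (EuclideanSpace ℝ (Fin n)) M] [IsManifold (𝓡 n) ∞ M]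
    (F : Type uF) [NormedAddCommGroup F] [NormedSpace ℝ F]
    (A : M → Type uA) [TopologicalSpace (Bundle.TotalSpace F A)]
    [∀ x, AddCommGroup (A x)] [∀ x, Module ℝ (A x)] [∀ x, TopologicalSpace (A x)]
    [FiberBundle F A] [VectorBundle ℝ F A] extends SkewAlgebroid n F A where
  jacobi : ∀ X Y Z,
    bracket X (bracket Y Z) = bracket (bracket X Y) Z + bracket Y (bracket X Z)
  /-- The anchor is a morphism of brackets (this also follows from the other axioms). -/
  anchor_bracket : ∀ X Y (f : SmoothFn n M), (anchor (bracket X Y)).deriv f =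
    (anchor X).deriv ((anchor Y).deriv f) - (anchor Y).deriv ((anchor X).deriv f)

variable {n : ℕ} {M : Type uM} [TopologicalSpace M]
  [ChartedSpace (EuclideanSpace ℝ (Fin n)) M] [IsManifold (𝓡 n) ∞ M]
  {F : Type uF} [NormedAddCommGroup F] [NormedSpace ℝ F]
  {A : M → Type uA} [TopologicalSpace (Bundle.TotalSpace F A)]
  [∀ x, AddCommGroup (A x)] [∀ x, Module ℝ (A x)] [∀ x, TopologicalSpace (A x)]
  [FiberBundle F A] [VectorBundle ℝ F A]

namespace SkewAlgebroid

variable (B : SkewAlgebroid n F A)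

/-- `ρ(X)(f)`. -/
def act (X : Sec n F A) (f : SmoothFn n M) : SmoothFn n M := (B.anchor X).deriv f

theorem bracket_skew (X Y : Sec n F A) : B.bracket X Y = -B.bracket Y X := by
  have h := B.bracket_self (X + Y)
  simp only [map_add, LinearMap.add_apply, B.bracket_self, zero_add, add_zero] at h
  exact eq_neg_of_add_eq_zero_right h

theorem leibniz_act (X : Sec n F A) (f : SmoothFn n M) (Y : Sec n F A) :
    B.bracket X (f • Y) = f • B.bracket X Y + B.act X f • Y := B.leibniz X f Y

theorem act_add (X : Sec n F A) (f g : SmoothFn n M) :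
    B.act X (f + g) = B.act X f + B.act X g := VecField.deriv_add _ _ _

theorem act_neg (X : Sec n F A) (f : SmoothFn n M) :
    B.act X (-f) = -B.act X f := VecField.deriv_neg _ _

theorem act_mul (X : Sec n F A) (f g : SmoothFn n M) :
    B.act X (f * g) = f * B.act X g + g * B.act X f := VecField.deriv_mul _ _ _

theorem add_act (X Y : Sec n F A) (f : SmoothFn n M) :
    B.act (X + Y) f = B.act X f + B.act Y f := by
  simp only [act, map_add, VecField.add_deriv]

theorem smul_act (g : SmoothFn n M) (X : Sec n F A) (f : SmoothFn n M) :
    B.act (g • X) f = g * B.act X f := by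
  simp only [act, map_smul, VecField.smul_deriv]

/-- The differential of a function: `(df)(X) = ρ(X)(f)`. -/
def d₀ (f : SmoothFn n M) : Cov n F A where
  toFun X := B.act X f
  map_add' X Y := B.add_act X Y f
  map_smul' g X := B.smul_act g X f

/-- The differential of a `1`-form:
`(dα)(X, Y) = ρ(X)(α(Y)) - ρ(Y)(α(X)) - α([X, Y])`. -/
def d₁ (α : Cov n F A) : TwoForm n F A :=
  .ofFun (fun X Y => B.act X (α Y) - B.act Y (α X) - α (B.bracket X Y))
    (fun X Y Y' => by simp only [map_add, act_add, add_act]; ring)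
    (fun X c Y => by
      simp only [map_smul, smul_eq_mul, act_mul, smul_act, leibniz_act, map_add]; ring)
    (fun X Y => by rw [B.bracket_skew X Y, map_neg]; ring)

/-- The differential of a `2`-form:
`(dσ)(X, Y, Z) = ρ(X)(σ(Y, Z)) - ρ(Y)(σ(X, Z)) + ρ(Z)(σ(X, Y))
  - σ([X, Y], Z) + σ([X, Z], Y) - σ([Y, Z], X)`. -/
def d₂ (σ : TwoForm n F A) : ThreeForm n F A :=
  .ofFun (fun X Y Z => B.act X (σ.toLin Y Z) - B.act Y (σ.toLin X Z) + B.act Z (σ.toLin X Y)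
      - σ.toLin (B.bracket X Y) Z + σ.toLin (B.bracket X Z) Y - σ.toLin (B.bracket Y Z) X)
    (fun X Y Z Z' => by simp only [map_add, act_add, add_act, LinearMap.add_apply]; ring)
    (fun X Y c Z => by
      simp only [map_smul, smul_eq_mul, act_mul, smul_act, leibniz_act, map_add,
        LinearMap.add_apply, LinearMap.smul_apply]
      rw [σ.skew Z X, σ.skew Z Y]; ring)
    (fun X Y Z => by
      rw [B.bracket_skew X Y, σ.skew X Y, map_neg, act_neg, LinearMap.neg_apply]; ring)
    (fun X Y Z => by
      rw [B.bracket_skew Y Z, σ.skew Y Z, map_neg, act_neg, LinearMap.neg_apply]; ring)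

/-- The differential of a `3`-form, evaluated on four sections:
`(dH)(X₀, …, X₃) = ∑ᵢ (-1)ⁱ ρ(Xᵢ)(H(…, X̂ᵢ, …)) + ∑_{i<j} (-1)^{i+j} H([Xᵢ, Xⱼ], …)`. -/
def d₃ (H : ThreeForm n F A) (X₀ X₁ X₂ X₃ : Sec n F A) : SmoothFn n M :=
  B.act X₀ (H.toLin X₁ X₂ X₃) - B.act X₁ (H.toLin X₀ X₂ X₃)
    + B.act X₂ (H.toLin X₀ X₁ X₃) - B.act X₃ (H.toLin X₀ X₁ X₂)
    - H.toLin (B.bracket X₀ X₁) X₂ X₃ + H.toLin (B.bracket X₀ X₂) X₁ X₃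
    - H.toLin (B.bracket X₀ X₃) X₁ X₂ - H.toLin (B.bracket X₁ X₂) X₀ X₃
    + H.toLin (B.bracket X₁ X₃) X₀ X₂ - H.toLin (B.bracket X₂ X₃) X₀ X₁

/-- A `3`-form is closed when `dH = 0`. -/
def IsClosed (H : ThreeForm n F A) : Prop := ∀ X₀ X₁ X₂ X₃, B.d₃ H X₀ X₁ X₂ X₃ = 0

/-- The Lie derivative of a `1`-form: `L_X β = i_X dβ + d(β(X))`, equivalently
`(L_X β)(Y) = ρ(X)(β(Y)) - β([X, Y])`. -/
def lieDer (X : Sec n F A) (β : Cov n F A) : Cov n F A :=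
  (B.d₁ β).toLin X + B.d₀ (β X)

/-- The deformation by a `(1,1)`-tensor `N`: the bracket
`[X, Y]_N = [NX, Y] + [X, NY] - N[X, Y]` with the anchor `ρ ∘ N`. Its differential is `d_N`. -/
def deform (N : Endo n F A) : SkewAlgebroid n F A where
  anchor := B.anchor.comp N
  bracket :=
    B.bracket.comp (N.restrictScalars ℝ) + B.bracket.compl₂ (N.restrictScalars ℝ)
      - B.bracket.compr₂ (N.restrictScalars ℝ)
  bracket_self X := by
    simp only [LinearMap.sub_apply, LinearMap.add_apply, LinearMap.comp_apply,
      LinearMap.compl₂_apply, LinearMap.compr₂_apply, LinearMap.coe_restrictScalars,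
      B.bracket_self, map_zero]
    rw [B.bracket_skew X (N X)]
    simp
  leibniz X f Y := by
    simp only [LinearMap.sub_apply, LinearMap.add_apply, LinearMap.comp_apply,
      LinearMap.compl₂_apply, LinearMap.compr₂_apply, LinearMap.coe_restrictScalars,
      B.leibniz, map_smul, map_add]
    module

/-- The Nijenhuis torsion `T_N(X, Y) = [NX, NY] - N([NX, Y] + [X, NY] - N[X, Y])`. -/
def torsion (N : Endo n F A) (X Y : Sec n F A) : Sec n F A :=
  B.bracket (N X) (N Y) - N (B.bracket (N X) Y + B.bracket X (N Y) - N (B.bracket X Y))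

/-- The bracket `[α, β]_π = L_{π♯α} β - L_{π♯β} α - d(π(α, β))` on `Γ(A*)`. -/
def piBracket (π : Bivector n F A) (α β : Cov n F A) : Cov n F A :=
  B.lieDer (π.sharp α) β - B.lieDer (π.sharp β) α - B.d₀ (π.eval α β)

/-- The concomitant `C_{π,N} = ([·,·]_N)_π - ([·,·]_π)_{ᵗN}`. -/
def concomitant (π : Bivector n F A) (N : Endo n F A) (α β : Cov n F A) : Cov n F A :=
  (B.deform N).piBracket π α β -
    (B.piBracket π (N.transpose α) β + B.piBracket π α (N.transpose β)
      - N.transpose (B.piBracket π α β))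

/-- The Schouten–Nijenhuis bracket of two bivectors, as a trivector evaluated on three `1`-forms:
`[P, Q](α, β, γ)` is the cyclic sum of `(L_{P♯α} β)(Q♯γ) + (L_{Q♯α} β)(P♯γ)`.
On decomposable bivectors it is given by
`[X₁ ∧ X₂, Y₁ ∧ Y₂] = ∑ᵢⱼ (-1)^{i+j} [Xᵢ, Yⱼ] ∧ X_{3-i} ∧ Y_{3-j}`. -/
def schouten (P Q : Bivector n F A) (α β γ : Cov n F A) : SmoothFn n M :=
  (B.lieDer (P.sharp α) β (Q.sharp γ) + B.lieDer (Q.sharp α) β (P.sharp γ))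
    + (B.lieDer (P.sharp β) γ (Q.sharp α) + B.lieDer (Q.sharp β) γ (P.sharp α))
    + (B.lieDer (P.sharp γ) α (Q.sharp β) + B.lieDer (Q.sharp γ) α (P.sharp β))

/-- `π` is a Poisson bivector: `[π, π] = 0` for the Schouten–Nijenhuis bracket. -/
def IsPoisson (π : Bivector n F A) : Prop := ∀ α β γ, B.schouten π π α β γ = 0

/-- Poisson quasi-Nijenhuis structures with background `(π, N, ψ, H)`. -/
structure IsPoissonQuasiNijenhuis (π : Bivector n F A) (N : Endo n F A)
    (ψ H : ThreeForm n F A) : Prop where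
  sharp_comm : ∀ α, N (π.sharp α) = π.sharp (N.transpose α)
  closed_psi : B.IsClosed ψ
  closed_background : B.IsClosed H
  poisson : B.IsPoisson π
  concomitant_eq : ∀ α β,
    B.concomitant π N α β = (2 : ℝ) • H.toLin (π.sharp α) (π.sharp β)
  torsion_eq : ∀ X Y,
    B.torsion N X Y = -π.sharp (H.toLin (N X) Y - H.toLin (N Y) X + ψ.toLin X Y)
  d_psi : ∀ X₀ X₁ X₂ X₃,
    (B.deform N).d₃ ψ X₀ X₁ X₂ X₃ = B.d₃ (H.contractTwice N) X₀ X₁ X₂ X₃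

end SkewAlgebroid

/-! ### The Courant algebroid `A ⊕ A*` -/

variable (n F A) in
/-- `Γ(A ⊕ A*) = Γ(A) ⊕ Γ(A*)`. -/
abbrev GenSec := Sec n F A × Cov n F A

/-- The pairing `⟨X + α, Y + β⟩ = β(X) + α(Y)`. -/
def pairing (u v : GenSec n F A) : SmoothFn n M := v.2 u.1 + u.2 v.1

/-- The endomorphism of `A ⊕ A*` with matrix `(N, π♯; σ♭, -ᵗN)`. -/
def matrixEndo (π : Bivector n F A) (N : Endo n F A) (σ : TwoForm n F A) :
    GenSec n F A →ₗ[SmoothFn n M] GenSec n F A where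
  toFun u := (N u.1 + π.sharp u.2, σ.flat u.1 - N.transpose u.2)
  map_add' u v := by
    ext1
    · simp only [Prod.fst_add, Prod.snd_add, map_add]; abel
    · simp only [Prod.fst_add, Prod.snd_add, map_add]; abel
  map_smul' c u := by
    ext1
    · simp only [Prod.smul_fst, Prod.smul_snd, map_smul, smul_add, RingHom.id_apply]
    · simp only [Prod.smul_fst, Prod.smul_snd, map_smul, smul_sub, RingHom.id_apply]

namespace SkewAlgebroid

variable (B : SkewAlgebroid n F A)

/-- The Dorfman bracket of `(A ⊕ A*, μ + H)`, i.e. the derived bracket `{{u, μ + H}, v}`: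
`[X + α, Y + β] = [X, Y] + L_X β - i_Y dα - H(X, Y, ·)`. -/
def dorfman (H : ThreeForm n F A) (u v : GenSec n F A) : GenSec n F A :=
  (B.bracket u.1 v.1, B.lieDer u.1 v.2 - (B.d₁ u.2).toLin v.1 - H.toLin u.1 v.1)

/-- The Nijenhuis torsion of an endomorphism `J` of `A ⊕ A*`:
`T_J(u, v) = [Ju, Jv] - J([Ju, v] + [u, Jv] - J[u, v])`. -/
def courantTorsion (H : ThreeForm n F A) (J : GenSec n F A →ₗ[SmoothFn n M] GenSec n F A)
    (u v : GenSec n F A) : GenSec n F A :=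
  B.dorfman H (J u) (J v)
    - J (B.dorfman H (J u) v + B.dorfman H u (J v) - J (B.dorfman H u v))

/-- `J` is a c.p.s. structure on `(A ⊕ A*, μ + H)` with `J² = lam · id`: it is orthogonal and
integrable, and `lam ∈ {-1, 0, 1}`. -/
structure IsCPS (H : ThreeForm n F A) (lam : ℝ)
    (J : GenSec n F A →ₗ[SmoothFn n M] GenSec n F A) : Prop where
  lam_mem : lam = -1 ∨ lam = 0 ∨ lam = 1
  orthogonal : ∀ u v, pairing (J u) v + pairing u (J v) = 0
  sq : ∀ u, J (J u) = lam • u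
  integrable : ∀ u v, B.courantTorsion H J u v = 0

end SkewAlgebroid

end Algebroid

end LieAlgebroidGeometry

end

open LieAlgebroidGeometry

noncomputable section

namespace LieAlgebroidGeometry

universe uM uF uA

/-! ### Separation of sections by smooth `1`-forms -/

section Separation

variable {n : ℕ} {M : Type uM} [TopologicalSpace M]
  [ChartedSpace (EuclideanSpace ℝ (Fin n)) M]
  {F : Type uF} [NormedAddCommGroup F] [NormedSpace ℝ F]
  {A : M → Type uA} [TopologicalSpace (Bundle.TotalSpace F A)]
  [∀ x, AddCommGroup (A x)] [∀ x, Module ℝ (A x)] [∀ x, TopologicalSpace (A x)]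
  [FiberBundle F A] [VectorBundle ℝ F A] [T2Space M] [IsManifold (𝓡 n) ∞ M]
  [ContMDiffVectorBundle ∞ F A (𝓡 n)]

/-! The matrix `J` is always skew for the pairing, because `π` and `σ` are skew. Its square is
scalar exactly when three block identities hold; the fourth block is the transpose of the first
(`matrixEndo_sq_iff`).

For skew `J` with scalar square, `⟨T_J(u, v), w⟩` is totally antisymmetric (`courantTorsion_swap`,
`pairing_courantTorsion_swap`), so by nondegeneracy of the pairing integrability is only a condition
on `T_J(X, Y)` and `T_J(α, β)`. Their four components are the remaining conditions. The `A`-part of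
`T_J(α, β)` is half of `[π, π]`, and its `A*`-part is half of `C_{π,N} - 2H(π♯α, π♯β, ·)`. The
`A`-part of `T_J(X, Y)` is the equation for `T_N` with `ψ = -dσ`, and its `A*`-part is half of the
difference of the two sides of the equation for `i_N dσ`.

Two conditions of the quasi-Nijenhuis structure are then automatic. The form `ψ` is closed by `d² =
0`. Since `d_N = i_N d - d i_N`, one has `d_N ψ = d(i_N dσ)`, which is `dℋ` by the last equation,
`d² = 0` and `dH = 0` (`LieAlgebroid.deform_d₃_neg_d₂`). -/

theorem contMDiff_bump_mul_trivialization {x₀ : M} (f : SmoothBumpFunction (𝓡 n) x₀)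
    (hf : tsupport f ⊆ (trivializationAt F A x₀).baseSet) (φ : F →L[ℝ] ℝ) (s : Sec n F A) :
    ContMDiff (𝓡 n) 𝓘(ℝ) ∞
      (fun y => f y * φ ((trivializationAt F A x₀).linearMapAt ℝ y (s y))) := by
  -- Smoothness matters only on the support of the bump, which lies where the trivialization is
  -- defined.
  refine contMDiff_of_tsupport fun y hy => ?_
  have hyb : y ∈ (trivializationAt F A x₀).baseSet := hf (tsupport_mul_subset_left hy)
  refine (f.contMDiff y).mul ?_
  have h1 := ((trivializationAt F A x₀).contMDiffAt_section_iff hyb).1 (s.contMDiff y)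
  have h2 : ContMDiffAt (𝓡 n) 𝓘(ℝ) ∞
      (fun y => φ ((trivializationAt F A x₀) ⟨y, s y⟩).2) y :=
    (φ.contMDiff (n := ∞)).contMDiffAt.comp y h1
  refine h2.congr_of_eventuallyEq ?_
  filter_upwards [(trivializationAt F A x₀).open_baseSet.mem_nhds hyb] with z hz
  rw [Bundle.Trivialization.coe_linearMapAt_of_mem _ hz]

/-- The smooth `1`-form given near `x₀` by a cut-off linear functional in a trivialization. -/
def bumpCov {x₀ : M} (f : SmoothBumpFunction (𝓡 n) x₀)
    (hf : tsupport f ⊆ (trivializationAt F A x₀).baseSet) (φ : F →L[ℝ] ℝ) : Cov n F A where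
  toFun s := ⟨_, contMDiff_bump_mul_trivialization f hf φ s⟩
  map_add' s t := by
    ext y
    change f y * φ ((trivializationAt F A x₀).linearMapAt ℝ y (s y + t y)) =
      f y * φ ((trivializationAt F A x₀).linearMapAt ℝ y (s y)) +
      f y * φ ((trivializationAt F A x₀).linearMapAt ℝ y (t y))
    simp only [map_add]; ring
  map_smul' c s := by
    ext y
    change f y * φ ((trivializationAt F A x₀).linearMapAt ℝ y (c y • s y)) =
      c y * (f y * φ ((trivializationAt F A x₀).linearMapAt ℝ y (s y)))
    simp only [map_smul, smul_eq_mul]; ring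

/-- The `1`-forms separate the sections of `A`. -/
theorem sec_eq_zero_of_forall_cov {X : Sec n F A} (h : ∀ γ : Cov n F A, γ X = 0) : X = 0 := by
  ext x
  have hx := FiberBundle.mem_baseSet_trivializationAt' (F := F) (E := A) x
  obtain ⟨f, -, hf⟩ := (SmoothBumpFunction.nhds_basis_tsupport (I := 𝓡 n) x).mem_iff.1
    ((trivializationAt F A x).open_baseSet.mem_nhds hx)
  have key : (trivializationAt F A x).linearMapAt ℝ x (X x) = 0 := by
    refine SeparatingDual.eq_zero_of_forall_dual_eq_zero (R := ℝ) fun φ => ?_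
    have h1 : f x * φ ((trivializationAt F A x).linearMapAt ℝ x (X x)) = 0 :=
      congrArg (fun g : SmoothFn n M => g x) (h (bumpCov f hf φ))
    simpa using h1
  have h2 := (trivializationAt F A x).symmₗ_linearMapAt (R := ℝ) hx (X x)
  rw [key, map_zero] at h2
  exact h2.symm

end Separation

/-! ### Pairing, Cartan calculus and symmetries of the Courant torsion -/

section Calculus

variable {n : ℕ} {M : Type uM} [TopologicalSpace M]
  [ChartedSpace (EuclideanSpace ℝ (Fin n)) M]
  {F : Type uF} [NormedAddCommGroup F] [NormedSpace ℝ F]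
  {A : M → Type uA} [TopologicalSpace (Bundle.TotalSpace F A)]
  [∀ x, AddCommGroup (A x)] [∀ x, Module ℝ (A x)] [∀ x, TopologicalSpace (A x)]
  [FiberBundle F A] [VectorBundle ℝ F A]

@[simp] theorem Endo.transpose_apply (N : Endo n F A) (α : Cov n F A) (X : Sec n F A) :
    N.transpose α X = α (N X) := rfl

@[simp] theorem TwoForm.flat_apply (σ : TwoForm n F A) (X : Sec n F A) :
    σ.flat X = σ.toLin X := rfl

@[simp] theorem TwoForm.contract_apply (N : Endo n F A) (σ : TwoForm n F A) (X Y : Sec n F A) :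
    (σ.contract N).toLin X Y = σ.toLin (N X) Y + σ.toLin X (N Y) := rfl

@[simp] theorem ThreeForm.neg_apply (H : ThreeForm n F A) (X Y Z : Sec n F A) :
    (-H).toLin X Y Z = -H.toLin X Y Z := rfl

@[simp] theorem ThreeForm.contract_apply (N : Endo n F A) (H : ThreeForm n F A)
    (X Y Z : Sec n F A) : (H.contract N).toLin X Y Z =
      H.toLin (N X) Y Z + H.toLin X (N Y) Z + H.toLin X Y (N Z) := rfl

@[simp] theorem ThreeForm.contractTwice_apply (N : Endo n F A) (H : ThreeForm n F A)
    (X Y Z : Sec n F A) : (H.contractTwice N).toLin X Y Z =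
      H.toLin (N X) (N Y) Z + H.toLin (N Y) (N Z) X + H.toLin (N Z) (N X) Y := rfl

theorem Bivector.sharp_skew (π : Bivector n F A) (α β : Cov n F A) :
    α (π.sharp β) = -β (π.sharp α) := by
  have h := π.skew (α + β)
  simp only [map_add, LinearMap.add_apply, π.skew, zero_add, add_zero] at h
  exact eq_neg_of_add_eq_zero_right h

theorem pairing_comm (u v : GenSec n F A) : pairing u v = pairing v u := add_comm _ _

theorem pairing_add_left (u v w : GenSec n F A) :
    pairing (u + v) w = pairing u w + pairing v w := by
  simp only [pairing, Prod.fst_add, Prod.snd_add, map_add, LinearMap.add_apply]; ring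

theorem pairing_sub_left (u v w : GenSec n F A) :
    pairing (u - v) w = pairing u w - pairing v w := by
  simp only [pairing, Prod.fst_sub, Prod.snd_sub, map_sub, LinearMap.sub_apply]; ring

theorem pairing_neg_left (u v : GenSec n F A) : pairing (-u) v = -pairing u v := by
  simp only [pairing, Prod.fst_neg, Prod.snd_neg, map_neg, LinearMap.neg_apply]; ring

theorem pairing_smul_left (r : ℝ) (u v : GenSec n F A) :
    pairing (r • u) v = r • pairing u v := by
  simp only [pairing, Prod.smul_fst, Prod.smul_snd, LinearMap.map_smul_of_tower,
    LinearMap.smul_apply, smul_add]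

theorem pairing_add_right (u v w : GenSec n F A) :
    pairing u (v + w) = pairing u v + pairing u w := by
  simp only [pairing_comm u, pairing_add_left]

theorem pairing_smul_right (r : ℝ) (u v : GenSec n F A) :
    pairing u (r • v) = r • pairing u v := by
  simp only [pairing_comm u, pairing_smul_left]

theorem orthogonal_matrixEndo (π : Bivector n F A) (N : Endo n F A) (σ : TwoForm n F A)
    (u v : GenSec n F A) :
    pairing (matrixEndo π N σ u) v + pairing u (matrixEndo π N σ v) = 0 := by
  simp only [pairing, matrixEndo, LinearMap.coe_mk, AddHom.coe_mk, TwoForm.flat_apply,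
    LinearMap.sub_apply, map_add, Endo.transpose_apply]
  rw [π.sharp_skew v.2, σ.skew u.1]
  ring

theorem pairing_map_map {lam : ℝ} {J : GenSec n F A →ₗ[SmoothFn n M] GenSec n F A}
    (ho : ∀ u v, pairing (J u) v + pairing u (J v) = 0)
    (hs : ∀ u, J (J u) = lam • u) (u v : GenSec n F A) :
    pairing (J u) (J v) = -(lam • pairing u v) := by
  have h := ho u (J v)
  rw [hs, pairing_smul_right] at h
  exact eq_neg_of_add_eq_zero_left h

variable [IsManifold (𝓡 n) ∞ M]

namespace SkewAlgebroid

variable (B : SkewAlgebroid n F A)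

theorem act_zero (X : Sec n F A) : B.act X 0 = 0 := VecField.deriv_zero _

theorem zero_act (f : SmoothFn n M) : B.act 0 f = 0 := by
  simpa using B.add_act 0 0 f

theorem act_sub (X : Sec n F A) (f g : SmoothFn n M) :
    B.act X (f - g) = B.act X f - B.act X g := by
  rw [sub_eq_add_neg, act_add, act_neg, ← sub_eq_add_neg]

theorem act_smul (X : Sec n F A) (r : ℝ) (f : SmoothFn n M) :
    B.act X (r • f) = r • B.act X f := by
  ext x
  change mvfderiv (𝓡 n) (⇑(r • f)) x _ = r • mvfderiv (𝓡 n) f x _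
  have h := mvfderiv_smul (I := 𝓡 n) (x := x) (a := fun _ : M => r)
    mdifferentiableAt_const (mdiff_smoothFn f x)
  have h' : ((fun _ : M => r) • (f : M → ℝ)) = ⇑(r • f) := rfl
  rw [← h', h]
  simp [mvfderiv_const]

@[simp] theorem d₀_apply (f : SmoothFn n M) (X : Sec n F A) : B.d₀ f X = B.act X f := rfl

@[simp] theorem d₁_apply (α : Cov n F A) (X Y : Sec n F A) :
    (B.d₁ α).toLin X Y = B.act X (α Y) - B.act Y (α X) - α (B.bracket X Y) := rfl

@[simp] theorem d₂_apply (σ : TwoForm n F A) (X Y Z : Sec n F A) :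
    (B.d₂ σ).toLin X Y Z =
      B.act X (σ.toLin Y Z) - B.act Y (σ.toLin X Z) + B.act Z (σ.toLin X Y)
      - σ.toLin (B.bracket X Y) Z + σ.toLin (B.bracket X Z) Y - σ.toLin (B.bracket Y Z) X := rfl

@[simp] theorem lieDer_apply (X : Sec n F A) (β : Cov n F A) (Y : Sec n F A) :
    B.lieDer X β Y = B.act X (β Y) - β (B.bracket X Y) := by
  simp only [lieDer, LinearMap.add_apply, d₁_apply, d₀_apply]; ring

theorem deform_act (N : Endo n F A) (X : Sec n F A) (f : SmoothFn n M) :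
    (B.deform N).act X f = B.act (N X) f := rfl

theorem deform_bracket (N : Endo n F A) (X Y : Sec n F A) :
    (B.deform N).bracket X Y = B.bracket (N X) Y + B.bracket X (N Y) - N (B.bracket X Y) := rfl

/-- `d_N = i_N d - d i_N` on `3`-forms. -/
theorem deform_d₃ (N : Endo n F A) (K : ThreeForm n F A) (X₀ X₁ X₂ X₃ : Sec n F A) :
    (B.deform N).d₃ K X₀ X₁ X₂ X₃ =
      B.d₃ K (N X₀) X₁ X₂ X₃ + B.d₃ K X₀ (N X₁) X₂ X₃ + B.d₃ K X₀ X₁ (N X₂) X₃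
        + B.d₃ K X₀ X₁ X₂ (N X₃) - B.d₃ (K.contract N) X₀ X₁ X₂ X₃ := by
  simp only [d₃, deform_act, deform_bracket, ThreeForm.contract_apply, act_add, map_add, map_sub,
    LinearMap.add_apply, LinearMap.sub_apply]
  ring

theorem d₃_neg (K : ThreeForm n F A) (X₀ X₁ X₂ X₃ : Sec n F A) :
    B.d₃ (-K) X₀ X₁ X₂ X₃ = -B.d₃ K X₀ X₁ X₂ X₃ := by
  simp only [d₃, ThreeForm.neg_apply, act_neg]
  ring

end SkewAlgebroid

namespace LieAlgebroid

variable (μ : LieAlgebroid n F A)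

theorem bracket_act (X Y : Sec n F A) (f : SmoothFn n M) :
    μ.act (μ.bracket X Y) f = μ.act X (μ.act Y f) - μ.act Y (μ.act X f) :=
  μ.anchor_bracket X Y f

/-- The Jacobi identity with every double bracket nested on the left, the shape in which double
brackets occur in `d₂` and `d₃`. -/
theorem bracket_bracket (X Y Z : Sec n F A) :
    μ.bracket (μ.bracket Y Z) X = μ.bracket (μ.bracket X Z) Y - μ.bracket (μ.bracket X Y) Z := by
  have h := μ.jacobi X Y Z
  rw [μ.bracket_skew X (μ.bracket Y Z), μ.bracket_skew Y (μ.bracket X Z)] at h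
  rw [← neg_inj, h]; abel

/-- Second derivatives cancel because the anchor preserves brackets, double brackets by Jacobi, and
the rest by skewness of `σ`. -/
theorem isClosed_d₂ (σ : TwoForm n F A) : μ.IsClosed (μ.d₂ σ) := by
  intro X₀ X₁ X₂ X₃
  have e (X Y Z W : Sec n F A) := congrArg (fun V => σ.toLin V W) (μ.bracket_bracket X Y Z)
  simp only [map_sub, LinearMap.sub_apply] at e
  simp only [SkewAlgebroid.d₃, SkewAlgebroid.d₂_apply, SkewAlgebroid.act_add,
    SkewAlgebroid.act_sub, bracket_act]
  rw [e X₀ X₁ X₂, e X₀ X₁ X₃, e X₀ X₂ X₃, e X₁ X₂ X₃,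
    σ.skew (μ.bracket X₂ X₃) (μ.bracket X₀ X₁), σ.skew (μ.bracket X₁ X₃) (μ.bracket X₀ X₂),
    σ.skew (μ.bracket X₁ X₂) (μ.bracket X₀ X₃)]
  have s (X Y Z W : Sec n F A) : μ.act W (σ.toLin (μ.bracket X Y) Z) =
    - μ.act W (σ.toLin Z (μ.bracket X Y)) := by rw [σ.skew, SkewAlgebroid.act_neg]
  simp only [s]
  ring

end LieAlgebroid

namespace SkewAlgebroid

variable (B : SkewAlgebroid n F A) (H : ThreeForm n F A)

theorem dorfman_add_left (u u' v : GenSec n F A) :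
    B.dorfman H (u + u') v = B.dorfman H u v + B.dorfman H u' v := by
  refine Prod.ext ?_ (LinearMap.ext fun Z => ?_)
  · simp [dorfman]
  · simp [dorfman, act_add, add_act]; ring

theorem dorfman_add_right (u v v' : GenSec n F A) :
    B.dorfman H u (v + v') = B.dorfman H u v + B.dorfman H u v' := by
  refine Prod.ext ?_ (LinearMap.ext fun Z => ?_)
  · simp [dorfman]
  · simp [dorfman, act_add]; ring

/-- Invariance of the pairing under the Dorfman bracket. -/
theorem pairing_dorfman (u v w : GenSec n F A) :
    pairing (B.dorfman H u v) w + pairing v (B.dorfman H u w) = B.act u.1 (pairing v w) := by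
  simp only [pairing, dorfman, LinearMap.sub_apply, lieDer_apply, d₁_apply, act_add]
  rw [H.skew₂₃ u.1 v.1 w.1, B.bracket_skew w.1 v.1, map_neg]
  ring

/-- The symmetric part of the Dorfman bracket. -/
theorem dorfman_add_dorfman_swap (u v : GenSec n F A) :
    B.dorfman H u v + B.dorfman H v u = (0, B.d₀ (pairing u v)) := by
  refine Prod.ext ?_ (LinearMap.ext fun Z => ?_)
  · simp [dorfman, B.bracket_skew v.1 u.1]
  · simp only [dorfman, Prod.mk_add_mk, LinearMap.add_apply, LinearMap.sub_apply, lieDer_apply,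
      d₁_apply, d₀_apply, pairing, act_add]
    rw [H.skew₁₂ u.1 v.1]
    ring

variable {B H} {lam : ℝ} {J : GenSec n F A →ₗ[SmoothFn n M] GenSec n F A}

/-- Additivity suffices for splitting arguments into their `A` and `A*` parts; tensoriality of the
torsion is not needed. -/
theorem courantTorsion_add_left (u u' v : GenSec n F A) :
    B.courantTorsion H J (u + u') v = B.courantTorsion H J u v + B.courantTorsion H J u' v := by
  simp only [courantTorsion, map_add, map_sub, dorfman_add_left]; abel

theorem courantTorsion_add_right (u v v' : GenSec n F A) :
    B.courantTorsion H J u (v + v') = B.courantTorsion H J u v + B.courantTorsion H J u v' := by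
  simp only [courantTorsion, map_add, map_sub, dorfman_add_right]; abel

/-- The symmetric part of the Dorfman bracket is `d` of the pairing, so that of the torsion is
`d⟨Ju, Jv⟩ - J d(⟨Ju, v⟩ + ⟨u, Jv⟩) + J² d⟨u, v⟩`. The middle term vanishes by skewness of `J`; the
outer ones are `∓lam · d⟨u, v⟩`. -/
theorem courantTorsion_swap (ho : ∀ u v, pairing (J u) v + pairing u (J v) = 0)
    (hs : ∀ u, J (J u) = lam • u) (u v : GenSec n F A) :
    B.courantTorsion H J u v = -B.courantTorsion H J v u := by
  have h1 := B.dorfman_add_dorfman_swap H (J u) (J v)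
  have h2 := B.dorfman_add_dorfman_swap H (J u) v
  have h3 := B.dorfman_add_dorfman_swap H u (J v)
  have h4 := B.dorfman_add_dorfman_swap H u v
  have e1 : ((0, B.d₀ (pairing (J u) (J v))) : GenSec n F A) =
      -(lam • (0, B.d₀ (pairing u v))) := by
    rw [pairing_map_map ho hs]
    refine Prod.ext (by simp) (LinearMap.ext fun Z => ?_)
    simp [act_neg, act_smul]
  have e2 : ((0, B.d₀ (pairing (J u) v)) : GenSec n F A) + (0, B.d₀ (pairing u (J v))) = 0 := by
    refine Prod.ext (by simp) (LinearMap.ext fun Z => ?_)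
    simp [← act_add, ho, act_zero]
  have e3 : B.courantTorsion H J u v + B.courantTorsion H J v u =
      (B.dorfman H (J u) (J v) + B.dorfman H (J v) (J u))
      - J ((B.dorfman H (J u) v + B.dorfman H v (J u))
        + (B.dorfman H u (J v) + B.dorfman H (J v) u))
      + J (J (B.dorfman H u v + B.dorfman H v u)) := by
    simp only [courantTorsion, map_add, map_sub]; abel
  refine eq_neg_of_add_eq_zero_left ?_
  rw [e3, h1, h2, h3, h4, e1, e2, hs]
  simp

/-- Moving `J` across the pairing leaves four Dorfman terms. Invariance of the pairing swaps `v` and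
`w` in each, at the cost of derivatives of `⟨Jv, w⟩ + ⟨v, Jw⟩` along `Ju` and of `⟨Jv, Jw⟩ + lam ·
⟨v, w⟩` along `u`; both functions are zero. -/
theorem pairing_courantTorsion_swap (ho : ∀ u v, pairing (J u) v + pairing u (J v) = 0)
    (hs : ∀ u, J (J u) = lam • u) (u v w : GenSec n F A) :
    pairing (B.courantTorsion H J u v) w = -pairing (B.courantTorsion H J u w) v := by
  have e (v w : GenSec n F A) : pairing (B.courantTorsion H J u v) w =
      pairing (B.dorfman H (J u) (J v)) w + pairing (B.dorfman H (J u) v) (J w)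
        + pairing (B.dorfman H u (J v)) (J w) + lam • pairing (B.dorfman H u v) w := by
    have h1 := ho (B.dorfman H (J u) v) w
    have h2 := ho (B.dorfman H u (J v)) w
    simp only [courantTorsion, map_sub, map_add, hs, pairing_sub_left, pairing_add_left,
      pairing_smul_left]
    linear_combination -h1 - h2
  have h1 := B.pairing_dorfman H (J u) (J v) w
  have h2 := B.pairing_dorfman H (J u) v (J w)
  have h3 := B.pairing_dorfman H u (J v) (J w)
  have h4 := congrArg (lam • ·) (B.pairing_dorfman H u v w)
  have h5 : B.act (J u).1 (pairing (J v) w) + B.act (J u).1 (pairing v (J w)) = 0 := by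
    rw [← act_add, ho, act_zero]
  rw [pairing_map_map ho hs, act_neg, act_smul] at h3
  simp only [smul_add] at h4
  rw [e, e, pairing_comm (B.dorfman H (J u) (J w)), pairing_comm (B.dorfman H (J u) w),
    pairing_comm (B.dorfman H u (J w)), pairing_comm (B.dorfman H u w)]
  linear_combination (exp := 1) h1 + h2 + h3 + h4 + h5

end SkewAlgebroid

end Calculus

/-! ### Block components of `J²` and of the torsion of `J` -/

section MatrixTorsion

variable {n : ℕ} {M : Type uM} [TopologicalSpace M]
  [ChartedSpace (EuclideanSpace ℝ (Fin n)) M]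
  {F : Type uF} [NormedAddCommGroup F] [NormedSpace ℝ F]
  {A : M → Type uA} [TopologicalSpace (Bundle.TotalSpace F A)]
  [∀ x, AddCommGroup (A x)] [∀ x, Module ℝ (A x)] [∀ x, TopologicalSpace (A x)]
  [FiberBundle F A] [VectorBundle ℝ F A]
  {π : Bivector n F A} {N : Endo n F A} {σ : TwoForm n F A}

theorem matrixEndo_apply (u : GenSec n F A) :
    matrixEndo π N σ u = (N u.1 + π.sharp u.2, σ.flat u.1 - N.transpose u.2) := rfl

theorem matrixEndo_sq_iff {lam : ℝ} :
    (∀ u, matrixEndo π N σ (matrixEndo π N σ u) = lam • u) ↔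
      (∀ α, N (π.sharp α) = π.sharp (N.transpose α)) ∧
      (∀ X, N (N X) + π.sharp (σ.flat X) = lam • X) ∧
      (∀ X, σ.flat (N X) = N.transpose (σ.flat X)) := by
  constructor
  · intro h
    refine ⟨fun α => ?_, fun X => ?_, fun X => ?_⟩
    · have := congrArg Prod.fst (h (0, α))
      simp only [matrixEndo_apply, map_zero, zero_add, zero_sub, map_neg, Prod.smul_mk,
        smul_zero] at this
      exact sub_eq_zero.1 (by rw [sub_eq_add_neg]; exact this)
    · simpa [matrixEndo_apply] using congrArg Prod.fst (h (X, 0))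
    · have := congrArg Prod.snd (h (X, 0))
      simp only [matrixEndo_apply, map_zero, add_zero, sub_zero, Prod.smul_mk,
        smul_zero] at this
      exact sub_eq_zero.1 this
  · rintro ⟨h₁, h₂, h₃⟩ u
    refine Prod.ext ?_ (LinearMap.ext fun Z => ?_)
    · simp only [matrixEndo_apply, map_add, map_sub, Prod.smul_fst]
      rw [h₁, ← h₂ u.1]; abel
    -- The lower right block: as `π` and `σ` are skew, `σ♭π♯` is the transpose of `π♯σ♭`.
    · have e₁ : σ.toLin (π.sharp u.2) Z = u.2 (π.sharp (σ.flat Z)) := by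
        rw [π.sharp_skew, σ.skew]; rfl
      have e₂ := congrArg u.2 (h₂ Z)
      have e₃ := LinearMap.congr_fun (h₃ u.1) Z
      simp only [TwoForm.flat_apply, Endo.transpose_apply, map_add,
        LinearMap.map_smul_of_tower] at e₁ e₂ e₃
      simp only [matrixEndo_apply, map_add, map_sub, Prod.smul_snd, LinearMap.add_apply,
        LinearMap.sub_apply, LinearMap.smul_apply, Endo.transpose_apply, TwoForm.flat_apply]
      linear_combination (exp := 1) e₁ + e₂ + e₃

variable [IsManifold (𝓡 n) ∞ M]

namespace SkewAlgebroid

variable (B : SkewAlgebroid n F A) (H : ThreeForm n F A)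

theorem lieDer_zero_left (β : Cov n F A) : B.lieDer 0 β = 0 := by
  ext1 Z; simp [zero_act]

theorem lieDer_zero_right (X : Sec n F A) : B.lieDer X 0 = 0 := by
  ext1 Z; simp [act_zero]

theorem d₁_zero (X : Sec n F A) : (B.d₁ 0).toLin X = 0 := by
  ext1 Z; simp [act_zero]

/-- The exact part of `L_{π♯β} α` cancels `d(π(α, β))`. What is left is the form that the Dorfman
bracket produces. -/
theorem piBracket_eq (α β : Cov n F A) :
    B.piBracket π α β = B.lieDer (π.sharp α) β - (B.d₁ α).toLin (π.sharp β) := by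
  ext1 Z
  simp only [piBracket, Bivector.eval, LinearMap.sub_apply, lieDer_apply, d₁_apply, d₀_apply]
  rw [π.sharp_skew α β, act_neg]
  ring

/-- Two covectors have zero Dorfman bracket, so the `J²` term drops out, and `H` enters only through
`[Jα, Jβ]`. -/
theorem courantTorsion_cov_cov (α β : Cov n F A) :
    B.courantTorsion H (matrixEndo π N σ) (0, α) (0, β) =
      (B.bracket (π.sharp α) (π.sharp β) - π.sharp (B.piBracket π α β),
        (B.d₁ (N.transpose α)).toLin (π.sharp β) - B.lieDer (π.sharp α) (N.transpose β)
          - H.toLin (π.sharp α) (π.sharp β) + N.transpose (B.piBracket π α β)) := by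
  have hn (X : Sec n F A) : B.lieDer X (-N.transpose β) = -B.lieDer X (N.transpose β) := by
    ext1 Z; simp [act_neg]; ring
  have hd (X : Sec n F A) : (B.d₁ (-N.transpose α)).toLin X =
      -(B.d₁ (N.transpose α)).toLin X := by
    ext1 Z; simp [act_neg]; ring
  simp only [courantTorsion, dorfman, matrixEndo_apply, map_zero, zero_add, zero_sub, hn, hd,
    LinearMap.zero_apply, lieDer_zero_left, sub_zero, Prod.mk_add_mk, add_zero, neg_zero,
    Prod.mk_sub_mk, piBracket_eq, ← sub_eq_add_neg, Prod.mk.injEq, true_and]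
  abel

/-- Identifies the Poisson condition with `π♯` being a morphism of brackets, up to separation by
`γ`. -/
theorem schouten_self_eq (α β γ : Cov n F A) :
    B.schouten π π α β γ =
      2 * γ (B.bracket (π.sharp α) (π.sharp β) - π.sharp (B.piBracket π α β)) := by
  rw [map_sub, π.sharp_skew γ, piBracket_eq]
  simp only [schouten, lieDer_apply, d₁_apply, LinearMap.sub_apply]
  rw [π.sharp_skew γ α, π.sharp_skew α β, B.bracket_skew (π.sharp β) (π.sharp α),
    B.bracket_skew (π.sharp γ) (π.sharp β)]
  simp only [act_neg, map_neg]
  ring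

/-- Once `π♯ ᵗN` is replaced by `N π♯`, derivatives and brackets along `N π♯α` and `N π♯β` cancel,
and the surviving terms occur twice. This is the origin of the factor in `2H`. -/
theorem concomitant_eq_two_mul (hc : ∀ α, N (π.sharp α) = π.sharp (N.transpose α))
    (α β : Cov n F A) (Z : Sec n F A) :
    B.concomitant π N α β Z =
      2 * ((B.d₁ (N.transpose α)).toLin (π.sharp β) - B.lieDer (π.sharp α) (N.transpose β)
          + N.transpose (B.piBracket π α β)) Z := by
  simp only [concomitant, piBracket_eq, LinearMap.sub_apply, LinearMap.add_apply,
    Endo.transpose_apply, lieDer_apply, d₁_apply, deform_act, deform_bracket, map_add,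
    map_sub, ← hc]
  ring

theorem courantTorsion_sec_sec_fst (hc : ∀ α, N (π.sharp α) = π.sharp (N.transpose α))
    (X Y : Sec n F A) :
    (B.courantTorsion H (matrixEndo π N σ) (X, 0) (Y, 0)).1 =
      B.torsion N X Y +
        π.sharp (H.toLin (N X) Y - H.toLin (N Y) X + (-(B.d₂ σ)).toLin X Y) := by
  -- Cartan's formula for `i_Y i_X dσ`: the `σ`-terms under `π♯` assemble into `dσ`, which forces `ψ
  -- = -dσ`.
  have e : B.lieDer X (σ.toLin Y) - (B.d₁ (σ.toLin X)).toLin Y - σ.toLin (B.bracket X Y) =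
      (B.d₂ σ).toLin X Y := by
    ext1 Z
    simp only [LinearMap.sub_apply, lieDer_apply, d₁_apply, d₂_apply]
    rw [σ.skew Y (B.bracket X Z), σ.skew X (B.bracket Y Z)]; ring
  have e' : H.toLin (N Y) X = -H.toLin X (N Y) := LinearMap.ext fun Z => H.skew₁₂ _ _ _
  have e'' : (-(B.d₂ σ)).toLin X Y = -(B.d₂ σ).toLin X Y := rfl
  rw [e', e'', ← e]
  simp only [courantTorsion, dorfman, matrixEndo_apply, map_zero, add_zero, sub_zero,
    Prod.mk_add_mk, lieDer_zero_right, d₁_zero, zero_sub, map_add, map_sub, map_neg,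
    Prod.mk_sub_mk, torsion, TwoForm.flat_apply, hc]
  abel

/-- The term `2 lam H` comes from `J²` acting on the `H`-part of `[X, Y]`: there `σ♭π♯ + (ᵗN)²`
appears, the transpose of `π♯σ♭ + N²`. Commutation of `σ♭` with `N` matches the other terms. -/
theorem two_mul_courantTorsion_sec_sec_snd {lam : ℝ}
    (h₁ : ∀ X, N (N X) + π.sharp (σ.flat X) = lam • X)
    (h₂ : ∀ X, σ.flat (N X) = N.transpose (σ.flat X)) (X Y Z : Sec n F A) :
    2 * (B.courantTorsion H (matrixEndo π N σ) (X, 0) (Y, 0)).2 Z =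
      (2 : ℝ) • (((B.d₂ σ).contract N).toLin X Y Z - (H.contractTwice N).toLin X Y Z) -
        ((B.d₂ (σ.contract N)).toLin X Y Z + (2 * lam) • H.toLin X Y Z) := by
  have e₁ := congrArg (H.toLin X Y) (h₁ Z)
  have e₂ : σ.toLin (π.sharp (H.toLin X Y)) Z = H.toLin X Y (π.sharp (σ.flat Z)) := by
    rw [π.sharp_skew, σ.skew]; rfl
  have e₃ (X Y : Sec n F A) : σ.toLin (N X) Y = σ.toLin X (N Y) :=
    LinearMap.congr_fun (h₂ X) Y
  simp only [map_add, LinearMap.map_smul_of_tower, TwoForm.flat_apply] at e₁ e₂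
  simp only [courantTorsion, dorfman, matrixEndo_apply, map_zero, add_zero, sub_zero,
    Prod.mk_add_mk, lieDer_zero_right, d₁_zero, zero_sub, map_add, map_sub, map_neg,
    Prod.mk_sub_mk, TwoForm.flat_apply,
    LinearMap.add_apply, LinearMap.sub_apply, LinearMap.neg_apply, Endo.transpose_apply,
    lieDer_apply, d₁_apply, d₂_apply, ThreeForm.contract_apply, ThreeForm.contractTwice_apply,
    TwoForm.contract_apply, act_add, two_smul, mul_smul, e₂, e₃]
  rw [σ.skew Y (B.bracket (N X) Z), σ.skew X (B.bracket (N Y) Z), H.skew₁₂ (N Z) (N X) Y,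
    H.skew₂₃ (N X) (N Z) Y, H.skew₁₂ (N Y) (N Z) X, H.skew₂₃ (N Z) (N Y) X, H.skew₁₂ (N Z) X,
    H.skew₂₃ X (N Z) (N Y), σ.skew Y (B.bracket X (N Z)), σ.skew X (B.bracket Y (N Z))]
  linear_combination (exp := 1) (-2) * e₁

end SkewAlgebroid

end MatrixTorsion

/-! ### Redundancy of the `d_N ψ` condition and reduction to pure arguments -/

section Integrability

variable {n : ℕ} {M : Type uM} [TopologicalSpace M]
  [ChartedSpace (EuclideanSpace ℝ (Fin n)) M] [IsManifold (𝓡 n) ∞ M]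
  {F : Type uF} [NormedAddCommGroup F] [NormedSpace ℝ F]
  {A : M → Type uA} [TopologicalSpace (Bundle.TotalSpace F A)]
  [∀ x, AddCommGroup (A x)] [∀ x, Module ℝ (A x)] [∀ x, TopologicalSpace (A x)]
  [FiberBundle F A] [VectorBundle ℝ F A]

theorem LieAlgebroid.deform_d₃_neg_d₂ (μ : LieAlgebroid n F A) {H : ThreeForm n F A}
    {N : Endo n F A} {σ : TwoForm n F A} {lam : ℝ} (hH : μ.IsClosed H)
    (h : ∀ X Y Z, (2 : ℝ) • (((μ.d₂ σ).contract N).toLin X Y Z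
        - (H.contractTwice N).toLin X Y Z) =
      (μ.d₂ (σ.contract N)).toLin X Y Z + (2 * lam) • H.toLin X Y Z)
    (X₀ X₁ X₂ X₃ : Sec n F A) :
    (μ.deform N).d₃ (-(μ.d₂ σ)) X₀ X₁ X₂ X₃ = μ.d₃ (H.contractTwice N) X₀ X₁ X₂ X₃ := by
  -- Solve the hypothesis for `i_N dσ`, so that `d` can be applied to both sides.
  have e (X Y Z : Sec n F A) : ((μ.d₂ σ).contract N).toLin X Y Z =
      (H.contractTwice N).toLin X Y Z +
        ((1 / 2 : ℝ) • (μ.d₂ (σ.contract N)).toLin X Y Z + lam • H.toLin X Y Z) := by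
    have h' := congrArg ((1 / 2 : ℝ) • ·) (h X Y Z)
    have h₂ : (1 / 2 : ℝ) * 2 = 1 := by norm_num
    simp only [smul_add, smul_smul, ← mul_assoc, h₂, one_smul, one_mul] at h'
    exact sub_eq_iff_eq_add'.1 h'
  have e₁ := μ.isClosed_d₂ (σ.contract N) X₀ X₁ X₂ X₃
  have e₂ := hH X₀ X₁ X₂ X₃
  have hd : μ.d₃ ((μ.d₂ σ).contract N) X₀ X₁ X₂ X₃ =
      μ.d₃ (H.contractTwice N) X₀ X₁ X₂ X₃ +
        ((1 / 2 : ℝ) • μ.d₃ (μ.d₂ (σ.contract N)) X₀ X₁ X₂ X₃ +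
          lam • μ.d₃ H X₀ X₁ X₂ X₃) := by
    simp only [SkewAlgebroid.d₃, e, SkewAlgebroid.act_add, SkewAlgebroid.act_smul, smul_add,
      smul_sub]
    abel
  rw [e₁, e₂, smul_zero, smul_zero, add_zero, add_zero] at hd
  rw [SkewAlgebroid.d₃_neg, SkewAlgebroid.deform_d₃]
  simp only [μ.isClosed_d₂ σ _ _ _ _, hd, add_zero, zero_sub, neg_neg]

variable [T2Space M] [ContMDiffVectorBundle ∞ F A (𝓡 n)]

/-- Only the `A`-component needs bump forms; a covector is by definition determined by its values on
sections. -/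
theorem genSec_eq_zero_of_forall_pairing {u : GenSec n F A} (h : ∀ v, pairing u v = 0) :
    u = 0 := by
  refine Prod.ext (sec_eq_zero_of_forall_cov fun γ => ?_) (LinearMap.ext fun Z => ?_)
  · simpa [pairing] using h (0, γ)
  · simpa [pairing] using h (Z, 0)

/-- The torsion of an orthogonal `J` with `J² = lam · id` vanishes as soon as it vanishes on pairs
of sections of `A` and on pairs of sections of `A*`. -/
theorem SkewAlgebroid.courantTorsion_eq_zero {B : SkewAlgebroid n F A} {H : ThreeForm n F A}
    {lam : ℝ} {J : GenSec n F A →ₗ[SmoothFn n M] GenSec n F A}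
    (ho : ∀ u v, pairing (J u) v + pairing u (J v) = 0) (hs : ∀ u, J (J u) = lam • u)
    (h : ∀ X Y : Sec n F A, B.courantTorsion H J (X, 0) (Y, 0) = 0)
    (h' : ∀ α β : Cov n F A, B.courantTorsion H J (0, α) (0, β) = 0) (u v : GenSec n F A) :
    B.courantTorsion H J u v = 0 := by
  have split (u : GenSec n F A) : u = (u.1, 0) + (0, u.2) := by simp
  have zero (w : GenSec n F A) : pairing 0 w = 0 := by simp [pairing]
  have mixed (X : Sec n F A) (β : Cov n F A) : B.courantTorsion H J (X, 0) (0, β) = 0 := by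
    refine genSec_eq_zero_of_forall_pairing fun w => ?_
    -- Antisymmetry turns `⟨T(X, β), Y⟩` into `-⟨T(X, Y), β⟩` and `⟨T(X, β), γ⟩` into `⟨T(β, γ),
    -- X⟩`.
    rw [split w, pairing_add_right, pairing_courantTorsion_swap ho hs _ _ (w.1, 0), h, zero,
      courantTorsion_swap ho hs, pairing_neg_left,
      pairing_courantTorsion_swap ho hs, h', zero]
    simp
  rw [split u, split v, courantTorsion_add_left, courantTorsion_add_right,
    courantTorsion_add_right, h, h', mixed, courantTorsion_swap ho hs (0, u.2), mixed]
  simp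

end Integrability

end LieAlgebroidGeometry

end

/-! ### The equivalence -/

theorem mainTheorem3 {n : ℕ} {M : Type*} [TopologicalSpace M] [T2Space M]
    [SecondCountableTopology M] [ChartedSpace (EuclideanSpace ℝ (Fin n)) M]
    [IsManifold (𝓡 n) ∞ M]
    {F : Type*} [NormedAddCommGroup F] [NormedSpace ℝ F] [FiniteDimensional ℝ F]
    {A : M → Type*} [TopologicalSpace (Bundle.TotalSpace F A)]
    [∀ x, AddCommGroup (A x)] [∀ x, Module ℝ (A x)] [∀ x, TopologicalSpace (A x)]
    [FiberBundle F A] [VectorBundle ℝ F A] [ContMDiffVectorBundle ∞ F A (𝓡 n)]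
    (μ : LieAlgebroid n F A)
    (H : ThreeForm n F A) (hH : μ.IsClosed H)
    (π : Bivector n F A) (N : Endo n F A) (σ : TwoForm n F A)
    (lam : ℝ) (hlam : lam = -1 ∨ lam = 0 ∨ lam = 1) :
    μ.IsCPS H lam (matrixEndo π N σ) ↔
      μ.IsPoissonQuasiNijenhuis π N (-(μ.d₂ σ)) H ∧
      (∀ X, N (N X) + π.sharp (σ.flat X) = lam • X) ∧
      (∀ X, σ.flat (N X) = N.transpose (σ.flat X)) ∧
      (∀ X Y Z,
        (2 : ℝ) • (((μ.d₂ σ).contract N).toLin X Y Z - (H.contractTwice N).toLin X Y Z) =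
          (μ.d₂ (σ.contract N)).toLin X Y Z + (2 * lam) • H.toLin X Y Z) := by
  have ho := orthogonal_matrixEndo π N σ
  constructor
  · rintro ⟨-, -, hs, hi⟩
    obtain ⟨h₁, h₂, h₃⟩ := matrixEndo_sq_iff.1 hs
    have h₄ (X Y Z : Sec n F A) : (2 : ℝ) • (((μ.d₂ σ).contract N).toLin X Y Z
        - (H.contractTwice N).toLin X Y Z) =
          (μ.d₂ (σ.contract N)).toLin X Y Z + (2 * lam) • H.toLin X Y Z := by
      rw [← sub_eq_zero, ← μ.two_mul_courantTorsion_sec_sec_snd H h₂ h₃, hi]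
      exact mul_zero _
    refine ⟨⟨h₁, ?_, hH, ?_, ?_, ?_, ?_⟩, h₂, h₃, h₄⟩
    · intro X₀ X₁ X₂ X₃
      rw [SkewAlgebroid.d₃_neg, μ.isClosed_d₂, neg_zero]
    · intro α β γ
      have h := congrArg Prod.fst (hi (0, α) (0, β))
      rw [SkewAlgebroid.courantTorsion_cov_cov] at h
      rw [SkewAlgebroid.schouten_self_eq, show _ - _ = (0 : Sec n F A) from h]
      simp
    · intro α β
      have h := congrArg Prod.snd (hi (0, α) (0, β))
      rw [SkewAlgebroid.courantTorsion_cov_cov] at h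
      ext1 Z
      have hZ := LinearMap.congr_fun h Z
      rw [μ.concomitant_eq_two_mul h₁]
      simp only [LinearMap.add_apply, LinearMap.sub_apply, two_smul,
        Prod.snd_zero, LinearMap.zero_apply] at hZ ⊢
      linear_combination 2 * hZ
    · intro X Y
      have h := μ.courantTorsion_sec_sec_fst (σ := σ) H h₁ X Y
      rw [hi] at h
      exact eq_neg_of_add_eq_zero_left h.symm
    · exact μ.deform_d₃_neg_d₂ hH h₄
  · rintro ⟨hP, h₂, h₃, h₄⟩
    have hs := matrixEndo_sq_iff.2 ⟨hP.sharp_comm, h₂, h₃⟩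
    refine ⟨hlam, ho, hs, SkewAlgebroid.courantTorsion_eq_zero ho hs (fun X Y => ?_)
      fun α β => ?_⟩
    -- The component formulas give twice a function equal to zero; rewriting this as `f = -f`
    -- removes the factor, here and for the covectors below.
    · refine Prod.ext ?_ (LinearMap.ext fun Z => smoothFn_eq_zero_of_eq_neg ?_)
      · rw [μ.courantTorsion_sec_sec_fst H hP.sharp_comm, hP.torsion_eq]
        exact neg_add_cancel _
      · have h := μ.two_mul_courantTorsion_sec_sec_snd H h₂ h₃ X Y Z
        rw [h₄, sub_self, two_mul] at h
        exact eq_neg_of_add_eq_zero_left h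
    · rw [SkewAlgebroid.courantTorsion_cov_cov]
      refine Prod.ext (sec_eq_zero_of_forall_cov fun γ => smoothFn_eq_zero_of_eq_neg ?_)
        (LinearMap.ext fun Z => smoothFn_eq_zero_of_eq_neg ?_)
      · have h := hP.poisson α β γ
        rw [SkewAlgebroid.schouten_self_eq, two_mul] at h
        exact eq_neg_of_add_eq_zero_left h
      · have h := LinearMap.congr_fun (hP.concomitant_eq α β) Z
        rw [μ.concomitant_eq_two_mul hP.sharp_comm] at h
        simp only [LinearMap.add_apply, LinearMap.sub_apply, two_smul] at h ⊢
        linear_combination h
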